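/- **Theorem 2.1.** Let $D=d/dx$, and let $SOS\subset\mathbb{R}[x]$ be the set of finite sums of squares of real polynomials (it is well known that these are exactly the polynomials that are non-negative on $\mathbb{R}$); for $d\in\mathbb{N}_0$ let $SOS_d$ be the set of $f\in SOS$ with $\deg f\le d$. For real polynomials $f=\sum_i a_ix^i$, $g=\sum_i b_ix^i$ let $$\langle f,g\rangle=\sum_i i!\,a_ib_i=\frac1\pi\int_{\mathbb{C}}f(z)\overline{g(z)}e^{-|z|^2}\,dV(z)$$ be the Fischer–Fock inner product, where $dV$ is Lebesgue measure on $\mathbb{C}$, and for $K\subseteq\mathbb{R}[x]$ let $K^*=\{f\in\mathbb{R}[x]:\langle f,g\rangle\ge 0\text{ for all }g\in K\}$. Every linear operator $T:\mathbb{R}[x]\to\mathbb{R}[x]$ can be written in exactly one way as $T=\sum_{i=0}^\infty q_i(x)D^i$ with $q_i\in\mathbb{R}[x]$. For $y\in\mathbb{R}$ and $m\in\mathbb{N}_0$ put $$T_y=\sum_{i=0}^\infty q_i(y)D^i,\qquad p_{y,m}(x)=\sum_{i=0}^m q_i(y)x^i,\qquad \mathcal{H}_{y,m}=\big((i+j)!\,q_{i+j}(y)\big)_{i,j=0}^m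 .$$ Then the following assertions are equivalent: 1. $T(SOS)\subseteq SOS$; 2. $T_y(SOS)\subseteq SOS$ for all $y\in\mathbb{R}$; 3. $\langle p_{y,2m},f\rangle\ge0$ for all $y\in\mathbb{R}$, $m\in\mathbb{N}_0$ and $f\in SOS_{2m}$, i.e., $p_{y,2m}\in SOS_{2m}^*$ for all $y\in\mathbb{R}$, $m\in\mathbb{N}_0$; 4. the matrix $\mathcal{H}_{y,m}$ is positive semidefinite for all $y\in\mathbb{R}$, $m\in\mathbb{N}_0$; 5. there is a family $(\mu_s)_{s\in\mathbb{R}}$ of non-negative Borel measures on $\mathbb{R}$ with all moments finite, such that for each $i\in\mathbb{N}_0$ the moment $\int t^i\,d\mu_s(t)$ is a polynomial function of $s$, and $i!\,q_i(y)=\int t^i\,d\mu_y(t)$ for all $y\in\mathbb{R}$, $i\in\mathbb{N}_0$. Moreover, for every family $(\mu_s)_{s\in\mathbb{R}}$ as in (5), the operators $T_y$ are given by the convolutions $$T_y(f)(x)=\int f(t+x)\,d\mu_y(t),\qquad f\in\mathbb{R}[x],\ x,y\in\mathbb{R},$$ the integrand being $\mu_y$-integrable. -/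

import Mathlib

open Polynomial MeasureTheory
open scoped Nat ComplexConjugate

noncomputable section

namespace SosPreserver

/-- The cone of sums of squares of univariate real polynomials. -/
def SOS : Set ℝ[X] := {f | IsSumSq f}

/-- Sums of squares of degree at most `d`. -/
def SOSdeg (d : ℕ) : Set ℝ[X] := {f | f ∈ SOS ∧ f.degree ≤ d}

/-- The linear operators `T : ℝ[x] → ℝ[x]` with `T(V) ⊆ V`. -/
def preservers (V : Set ℝ[X]) : Set (ℝ[X] →ₗ[ℝ] ℝ[X]) := {T | ∀ f ∈ V, T f ∈ V}

theorem sum_extend (q : ℕ → ℝ[X]) (f : ℝ[X]) {N : ℕ} (hN : f.natDegree < N) :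
    ∑ i ∈ Finset.range (f.natDegree + 1), q i * derivative^[i] f =
      ∑ i ∈ Finset.range N, q i * derivative^[i] f := by
  apply Finset.sum_subset
  · intro i hi
    simp only [Finset.mem_range] at hi ⊢
    omega
  · intro i _ hi
    have h : f.natDegree < i := by
      simp only [Finset.mem_range] at hi
      omega
    rw [iterate_derivative_eq_zero h, mul_zero]

/-- The operator `∑_{i ≥ 0} q_i(x) D^i` with `D = d/dx`. Applied to `f` the sum is finite, since
`D^i f = 0` for `i > deg f`. -/
def diffOp (q : ℕ → ℝ[X]) : ℝ[X] →ₗ[ℝ] ℝ[X] where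
  toFun f := ∑ i ∈ Finset.range (f.natDegree + 1), q i * derivative^[i] f
  map_add' f g := by
    have hN : (f + g).natDegree < f.natDegree + g.natDegree + 1 := by
      have := natDegree_add_le f g
      omega
    rw [sum_extend q (f + g) hN, sum_extend q f (N := f.natDegree + g.natDegree + 1) (by omega),
      sum_extend q g (N := f.natDegree + g.natDegree + 1) (by omega), ← Finset.sum_add_distrib]
    simp only [iterate_map_add, mul_add]
  map_smul' c f := by
    have hN : (c • f).natDegree < f.natDegree + 1 := by
      have := natDegree_smul_le c f
      omega
    rw [sum_extend q (c • f) hN, RingHom.id_apply, Finset.smul_sum]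
    simp only [iterate_derivative_smul, mul_smul_comm]

/-- The coefficients, as constant polynomials, of the operator with `x` frozen at `y`. -/
def frozen (q : ℕ → ℝ[X]) (y : ℝ) : ℕ → ℝ[X] := fun i => C ((q i).eval y)

/-- The operator with constant coefficients `T_y = ∑_{i ≥ 0} q_i(y) D^i`. -/
def frozenOp (q : ℕ → ℝ[X]) (y : ℝ) : ℝ[X] →ₗ[ℝ] ℝ[X] := diffOp (frozen q y)

/-- The `m`-truncated symbol `p_{y,m}(x) = ∑_{i=0}^m q_i(y) x^i`. -/
def truncSymbol (q : ℕ → ℝ[X]) (y : ℝ) (m : ℕ) : ℝ[X] :=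
  ∑ i ∈ Finset.range (m + 1), C ((q i).eval y) * X ^ i

/-- The `(m+1) × (m+1)` Hankel matrix `((i+j)! q_{i+j}(y))_{i,j=0}^m`. -/
def hankel (q : ℕ → ℝ[X]) (y : ℝ) (m : ℕ) : Matrix (Fin (m + 1)) (Fin (m + 1)) ℝ :=
  Matrix.of fun i j => (((i : ℕ) + (j : ℕ))! : ℝ) * (q ((i : ℕ) + (j : ℕ))).eval y

/-- The Fischer–Fock inner product `⟨f, g⟩ = ∑ i! a_i b_i` of real polynomials `f = ∑ a_i x^i`,
`g = ∑ b_i x^i`; see `fischerFock_eq_integral` for the Gaussian integral form. -/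
def fischerFock (f g : ℝ[X]) : ℝ := f.sum fun i a => (i ! : ℝ) * a * g.coeff i

theorem integrable_norm_pow_gauss (k : ℕ) :
    Integrable (fun z : ℂ => ‖z‖ ^ k * Real.exp (-‖z‖ ^ 2)) := by
  have h := Complex.integral_rpow_mul_exp_neg_rpow (p := 2) (q := k) (by norm_num)
    (by have : (0 : ℝ) ≤ k := Nat.cast_nonneg k
        linarith)
  simp only [Real.rpow_natCast, Real.rpow_ofNat] at h
  by_contra hc
  rw [integral_undef hc] at h
  have : 0 < Real.Gamma (((k : ℝ) + 2) / 2) := Real.Gamma_pos_of_pos (by positivity)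
  have : 0 < 2 * Real.pi / 2 * Real.Gamma (((k : ℝ) + 2) / 2) := by positivity
  linarith

theorem integrable_monomial_gauss (m n : ℕ) :
    Integrable (fun z : ℂ => z ^ m * conj z ^ n * (Real.exp (-‖z‖ ^ 2) : ℂ)) := by
  refine (integrable_norm_pow_gauss (m + n)).mono' ?_ ?_
  · exact Continuous.aestronglyMeasurable (by fun_prop)
  · refine Filter.Eventually.of_forall fun z => le_of_eq ?_
    rw [norm_mul, norm_mul, norm_pow, norm_pow, RCLike.norm_conj, Complex.norm_real,
      Real.norm_eq_abs, Real.abs_exp, pow_add]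

theorem integral_monomial_gauss (m n : ℕ) :
    ∫ z : ℂ, z ^ m * conj z ^ n * (Real.exp (-‖z‖ ^ 2) : ℂ) =
      if m = n then (Real.pi * n ! : ℂ) else 0 := by
  split_ifs with hmn
  · subst hmn
    have h := Complex.integral_rpow_mul_exp_neg_rpow (p := 2) (q := (2 * m : ℕ)) (by norm_num)
      (by have : (0 : ℝ) ≤ (2 * m : ℕ) := Nat.cast_nonneg _
          linarith)
    simp only [Real.rpow_natCast, Real.rpow_ofNat] at h
    have e : (((2 * m : ℕ) : ℝ) + 2) / 2 = (m : ℝ) + 1 := by push_cast; ring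
    rw [e, Real.Gamma_nat_eq_factorial] at h
    have h2 : ∀ z : ℂ, z ^ m * conj z ^ m * (Real.exp (-‖z‖ ^ 2) : ℂ) =
        ((‖z‖ ^ (2 * m) * Real.exp (-‖z‖ ^ 2) : ℝ) : ℂ) := by
      intro z
      rw [← mul_pow, Complex.mul_conj, Complex.normSq_eq_norm_sq]
      push_cast
      rw [pow_mul]
    simp_rw [h2]
    rw [integral_complex_ofReal, h]
    push_cast
    ring
  · set I := ∫ z : ℂ, z ^ m * conj z ^ n * (Real.exp (-‖z‖ ^ 2) : ℂ) with hI
    set θ : ℝ := Real.pi / ((m : ℝ) - n) with hθ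
    have hne : ((m : ℂ) - n) ≠ 0 := sub_ne_zero.2 (by exact_mod_cast hmn)
    have hrot := (rotation (Circle.exp θ)).measurePreserving.integral_comp'
      (f := (rotation (Circle.exp θ)).toMeasurableEquiv)
      (fun z : ℂ => z ^ m * conj z ^ n * (Real.exp (-‖z‖ ^ 2) : ℂ))
    have hc : (Circle.exp θ : ℂ) ^ m * conj (Circle.exp θ : ℂ) ^ n = -1 := by
      rw [Circle.coe_exp, ← Complex.exp_conj, ← Complex.exp_nat_mul, ← Complex.exp_nat_mul,
        ← Complex.exp_add, ← Complex.exp_pi_mul_I]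
      congr 1
      rw [map_mul, Complex.conj_ofReal, Complex.conj_I, hθ]
      push_cast
      field_simp
      ring
    have h2 : ∀ z : ℂ, (Circle.exp θ * z : ℂ) ^ m * conj (Circle.exp θ * z : ℂ) ^ n *
        (Real.exp (-‖(Circle.exp θ * z : ℂ)‖ ^ 2) : ℂ) =
        -(z ^ m * conj z ^ n * (Real.exp (-‖z‖ ^ 2) : ℂ)) := by
      intro z
      rw [norm_mul, Circle.norm_coe, one_mul, map_mul, mul_pow, mul_pow]
      linear_combination (z ^ m * conj z ^ n * (Real.exp (-‖z‖ ^ 2) : ℂ)) * hc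
    have h3 : -I = I := by
      refine Eq.trans ?_ hrot
      rw [hI, ← integral_neg]
      exact integral_congr_ae (Filter.Eventually.of_forall fun z => (h2 z).symm)
    linear_combination (-1 / 2 : ℂ) * h3

/-- The Fischer–Fock inner product is the inner product
`π⁻¹ ∫_ℂ f(z) conj(g(z)) exp(-|z|²) dV(z)` of the Bargmann–Segal space. -/
theorem fischerFock_eq_integral (f g : ℝ[X]) :
    (fischerFock f g : ℂ) = (Real.pi : ℂ)⁻¹ *
      ∫ z : ℂ, aeval z f * conj (aeval z g) * (Real.exp (-‖z‖ ^ 2) : ℂ) := by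
  have hexp : ∀ z : ℂ, aeval z f * conj (aeval z g) * (Real.exp (-‖z‖ ^ 2) : ℂ) =
      ∑ i ∈ f.support, ∑ j ∈ g.support, ((f.coeff i : ℂ) * (g.coeff j : ℂ)) *
        (z ^ i * conj z ^ j * (Real.exp (-‖z‖ ^ 2) : ℂ)) := by
    intro z
    simp only [aeval_def, eval₂_eq_sum, Polynomial.sum, map_sum, map_mul, map_pow,
      Finset.sum_mul, Complex.coe_algebraMap, Complex.conj_ofReal]
    refine Finset.sum_congr rfl fun i _ => ?_
    rw [Finset.mul_sum, Finset.sum_mul]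
    refine Finset.sum_congr rfl fun j _ => ?_
    ring
  simp_rw [hexp]
  rw [integral_finsetSum _ fun i _ => integrable_finsetSum _ fun j _ =>
    (integrable_monomial_gauss i j).const_mul _]
  simp_rw [integral_finsetSum _ fun j _ => (integrable_monomial_gauss _ j).const_mul _,
    integral_const_mul, integral_monomial_gauss]
  have hpi : (Real.pi : ℂ) ≠ 0 := by exact_mod_cast Real.pi_ne_zero
  rw [fischerFock, Polynomial.sum, Finset.mul_sum]
  push_cast
  refine Finset.sum_congr rfl fun i _ => ?_
  simp only [mul_ite, mul_zero, Finset.sum_ite_eq, mem_support_iff]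
  split_ifs with h
  · field_simp
  · simp only [not_not] at h
    simp [h]

/-- The dual cone with respect to the Fischer–Fock inner product. -/
def dualCone (K : Set ℝ[X]) : Set ℝ[X] := {f | ∀ g ∈ K, 0 ≤ fischerFock f g}

/-- A nonnegative Borel measure on `ℝ` all of whose moments are finite. -/
def HasFiniteMoments (μ : Measure ℝ) : Prop := ∀ m : ℕ, Integrable (fun t : ℝ => t ^ m) μ

/-- The family `(μ_s)_{s ∈ ℝ}` consists of measures with all moments finite, each moment is a
polynomial function of `s`, and `i! q_i(y) = ∫ t^i dμ_y(t)` for all `i` and `y`. -/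
structure IsRepresentingFamily (q : ℕ → ℝ[X]) (μ : ℝ → Measure ℝ) : Prop where
  finite_moments : ∀ s : ℝ, HasFiniteMoments (μ s)
  polynomial_moments : ∀ i : ℕ, ∃ P : ℝ[X], ∀ s : ℝ, ∫ t, t ^ i ∂(μ s) = P.eval s
  moments_eq : ∀ (y : ℝ) (i : ℕ), (i ! : ℝ) * (q i).eval y = ∫ t, t ^ i ∂(μ y)

end SosPreserver

end

open SosPreserver

open Filter Topology CompactlySupported

noncomputable section

namespace SosPreserver

/-! ### Nonnegative polynomials on the line are sums of squares. -/

section SumsOfSquares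

/-! Everything reduces to the functionals `L_y : x^i ↦ i! q_i(y)`. By Taylor expansion `(T_y f)(x) =
L_y(f(· + x))`, and `(T f)(y) = (T_y f)(y)`. Since `SOS` is the cone of polynomials nonnegative on
`ℝ`, it is translation invariant, so preservation of `SOS` by `T`, or by every `T_y`, means exactly
that every `L_y` is nonnegative on `SOS`.

The other conditions are this positivity in different forms. The Fischer–Fock pairing with the
truncated symbol is `L_y` on polynomials of bounded degree, and the Hankel form at the coefficient
vector of `g` is `L_y(g²)`. Representing measures come from Haviland's theorem, proved here by M.
Riesz extension (`exists_positive_extension`) and the Riesz–Markov theorem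
(`exists_measure_of_nonneg`). Integrating Taylor shifts against them gives the convolution formula.
-/

theorem isSumSq_eval_nonneg {f : ℝ[X]} (hf : IsSumSq f) (x : ℝ) : 0 ≤ f.eval x := by
  induction hf using IsSumSq.rec' with
  | zero => simp
  | sq_add hx _ ih =>
    obtain ⟨g, rfl⟩ := hx
    rw [eval_add, eval_mul]
    exact add_nonneg (mul_self_nonneg _) ih

/-- A real root of a nonnegative polynomial is at least a double root, with nonnegative cofactor. -/
theorem exists_eq_sq_mul_of_eval_nonneg {p : ℝ[X]} (hp : ∀ x, 0 ≤ p.eval x) {a : ℝ}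
    (ha : p.eval a = 0) :
    ∃ s : ℝ[X], p = (X - C a) * (X - C a) * s ∧ ∀ x, 0 ≤ s.eval x := by
  obtain ⟨r, hr⟩ := dvd_iff_isRoot.2 (show p.IsRoot a from ha)
  have hra : r.eval a = 0 := by
    -- The root is a global minimum, so `p'(a) = r(a)` vanishes.
    have hmin : IsLocalMin (fun x => p.eval x) a :=
      Eventually.of_forall fun x => by simpa only [ha] using hp x
    have hd := hmin.deriv_eq_zero
    rw [Polynomial.deriv, hr, derivative_mul] at hd
    simpa using hd
  obtain ⟨s, hs⟩ := dvd_iff_isRoot.2 (show r.IsRoot a from hra)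
  have hps : p = (X - C a) * (X - C a) * s := by rw [hr, hs, mul_assoc]
  refine ⟨s, hps, ?_⟩
  have hne : ∀ x, x ≠ a → 0 ≤ s.eval x := by
    intro x hx
    have h := hp x
    rw [hps] at h
    simp only [eval_mul, eval_sub, eval_X, eval_C] at h
    exact nonneg_of_mul_nonneg_right h (mul_self_pos.2 (sub_ne_zero.2 hx))
  intro x
  rcases eq_or_ne x a with rfl | hx
  · have ht : Tendsto (fun y => s.eval y) (𝓝[≠] x) (𝓝 (s.eval x)) :=
      s.continuous.continuousAt.tendsto.mono_left nhdsWithin_le_nhds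
    exact ge_of_tendsto ht (eventually_nhdsWithin_of_forall fun y hy => hne y hy)
  · exact hne x hx

/-- A real polynomial that is nonnegative on `ℝ` is a sum of squares. -/
theorem isSumSq_of_eval_nonneg {p : ℝ[X]} (hp : ∀ x, 0 ≤ p.eval x) : IsSumSq p := by
  -- Each step splits off a double real root or a pair of conjugate roots; the cofactor stays
  -- nonnegative and has smaller degree.
  induction hn : p.natDegree using Nat.strong_induction_on generalizing p with
  | _ n ih =>
    subst hn
    rcases Nat.eq_zero_or_pos p.natDegree with h0 | hpos
    · rw [eq_C_of_natDegree_eq_zero h0] at hp ⊢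
      have hc : 0 ≤ p.coeff 0 := by simpa using hp 0
      rw [← Real.mul_self_sqrt hc, C_mul]
      exact IsSumSq.mul_self _
    · have hp0 : p ≠ 0 := by
        rintro rfl
        simp at hpos
      obtain ⟨z, hz⟩ := IsAlgClosed.exists_aeval_eq_zero ℂ p
        (natDegree_pos_iff_degree_pos.1 hpos).ne'
      by_cases him : z.im = 0
      · have hzr : z = (algebraMap ℝ ℂ) z.re := by
          apply Complex.ext <;> simp [him]
        have ha : p.eval z.re = 0 := by
          rw [hzr, aeval_algebraMap_apply] at hz
          simpa using hz
        obtain ⟨s, hs, hs0⟩ := exists_eq_sq_mul_of_eval_nonneg hp ha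
        have hsne : s ≠ 0 := by
          rintro rfl
          exact hp0 (by simpa using hs)
        have hX : (X - C z.re : ℝ[X]) ≠ 0 := X_sub_C_ne_zero _
        have hdeg : p.natDegree = 1 + 1 + s.natDegree := by
          conv_lhs => rw [hs]
          rw [natDegree_mul (mul_ne_zero hX hX) hsne, natDegree_mul hX hX, natDegree_X_sub_C]
        rw [hs]
        exact (IsSumSq.mul_self _).mul (ih s.natDegree (by omega) hs0 rfl)
      · obtain ⟨r, hr⟩ := p.quadratic_dvd_of_aeval_eq_zero_im_ne_zero hz him
        -- The quadratic with roots `z` and `conj z` is `(x - Re z)² + (Im z)²`: a sum of two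
        -- squares, strictly positive because `Im z ≠ 0`.
        have hq : (X ^ 2 - C (2 * z.re) * X + C (‖z‖ ^ 2) : ℝ[X]) =
            (X - C z.re) * (X - C z.re) + C z.im * C z.im := by
          rw [← Complex.normSq_eq_norm_sq, Complex.normSq_apply]
          simp only [C_add, C_mul, C_ofNat]
          ring
        have hmonic : (X ^ 2 - C (2 * z.re) * X + C (‖z‖ ^ 2) : ℝ[X]).natDegree = 2 := by
          compute_degree!
        have hrne : r ≠ 0 := by
          rintro rfl
          exact hp0 (by simpa using hr)
        have hqne : (X ^ 2 - C (2 * z.re) * X + C (‖z‖ ^ 2) : ℝ[X]) ≠ 0 := by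
          intro h
          rw [h] at hmonic
          simp at hmonic
        have hdeg : p.natDegree = 2 + r.natDegree := by
          conv_lhs => rw [hr]
          rw [natDegree_mul hqne hrne, hmonic]
        have hr0 : ∀ x, 0 ≤ r.eval x := by
          intro x
          have h := hp x
          rw [hr, hq] at h
          simp only [eval_mul, eval_add, eval_sub, eval_X, eval_C] at h
          exact nonneg_of_mul_nonneg_right h
            (add_pos_of_nonneg_of_pos (mul_self_nonneg _) (mul_self_pos.2 him))
        rw [hr, hq]
        exact ((IsSumSq.mul_self _).add (IsSumSq.mul_self _)).mul
          (ih r.natDegree (by omega) hr0 rfl)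

theorem mem_SOS_iff {f : ℝ[X]} : f ∈ SOS ↔ ∀ x, 0 ≤ f.eval x :=
  ⟨isSumSq_eval_nonneg, isSumSq_of_eval_nonneg⟩

end SumsOfSquares

/-! ### Moment functionals and Hankel forms. -/

section Functional

/-- The linear functional on `ℝ[x]` with `x ^ i ↦ s i`. -/
def momentFunctional (s : ℕ → ℝ) : ℝ[X] →ₗ[ℝ] ℝ :=
  Polynomial.lsum fun i => s i • LinearMap.id

theorem momentFunctional_eq_sum_range (s : ℕ → ℝ) {f : ℝ[X]} {n : ℕ} (hn : f.natDegree < n) :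
    momentFunctional s f = ∑ i ∈ Finset.range n, s i * f.coeff i := by
  rw [momentFunctional, lsum_apply]
  exact f.sum_over_range' (fun i => by simp) n hn

theorem momentFunctional_C_mul_X_pow (s : ℕ → ℝ) (a : ℝ) (n : ℕ) :
    momentFunctional s (C a * X ^ n) = a * s n := by
  rw [momentFunctional, lsum_apply, C_mul_X_pow_eq_monomial,
    sum_monomial_index _ _ (by simp)]
  simp [mul_comm]

theorem momentFunctional_X_pow (s : ℕ → ℝ) (n : ℕ) : momentFunctional s (X ^ n) = s n := by
  simpa using momentFunctional_C_mul_X_pow s 1 n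

theorem momentFunctional_nonneg_of_sq {s : ℕ → ℝ} (h : ∀ g, 0 ≤ momentFunctional s (g * g))
    {f : ℝ[X]} (hf : IsSumSq f) : 0 ≤ momentFunctional s f := by
  induction hf using IsSumSq.rec' with
  | zero => simp
  | sq_add hx _ ih =>
    obtain ⟨g, rfl⟩ := hx
    rw [map_add]
    exact add_nonneg (h g) ih

theorem momentFunctional_sum_mul_self (s : ℕ → ℝ) {m : ℕ} (v : Fin m → ℝ) :
    momentFunctional s ((∑ i, C (v i) * X ^ (i : ℕ)) * ∑ i, C (v i) * X ^ (i : ℕ)) =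
      v ⬝ᵥ (Matrix.of fun i j : Fin m => s ((i : ℕ) + (j : ℕ))).mulVec v := by
  rw [Finset.sum_mul_sum]
  simp only [map_sum, dotProduct, Matrix.mulVec, Matrix.of_apply, Finset.mul_sum]
  refine Finset.sum_congr rfl fun i _ => Finset.sum_congr rfl fun j _ => ?_
  rw [show C (v i) * X ^ (i : ℕ) * (C (v j) * X ^ (j : ℕ)) =
    C (v i * v j) * X ^ ((i : ℕ) + (j : ℕ)) by rw [C_mul, pow_add]; ring,
    momentFunctional_C_mul_X_pow]
  ring

/-- A functional is nonnegative on squares iff all Hankel matrices of its moments are positive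
semidefinite. -/
theorem forall_posSemidef_iff (s : ℕ → ℝ) :
    (∀ m : ℕ, (Matrix.of fun i j : Fin (m + 1) => s ((i : ℕ) + (j : ℕ))).PosSemidef) ↔
      ∀ g, 0 ≤ momentFunctional s (g * g) := by
  constructor
  · intro h g
    have hg : g = ∑ i : Fin (g.natDegree + 1), C (g.coeff i) * X ^ (i : ℕ) := by
      rw [Fin.sum_univ_eq_sum_range (fun i => C (g.coeff i) * X ^ i)]
      exact g.as_sum_range_C_mul_X_pow
    have := (h g.natDegree).dotProduct_mulVec_nonneg fun i => g.coeff i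
    rw [star_trivial, ← momentFunctional_sum_mul_self, ← hg] at this
    exact this
  · intro h m
    refine .of_dotProduct_mulVec_nonneg ?_ fun v => ?_
    · ext i j
      simp [add_comm]
    · rw [star_trivial, ← momentFunctional_sum_mul_self]
      exact h _

end Functional

/-! ### Reduction to the functionals of the frozen operators; existence and uniqueness of the
coefficients. -/

section Operators

/-- The functional `f ↦ (T_y f)(0)`. -/
def frozenFunctional (q : ℕ → ℝ[X]) (y : ℝ) : ℝ[X] →ₗ[ℝ] ℝ :=
  momentFunctional fun i => (i ! : ℝ) * (q i).eval y

theorem eval_iterate_derivative (f : ℝ[X]) (x : ℝ) (i : ℕ) :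
    (derivative^[i] f).eval x = (i ! : ℝ) * (taylor x f).coeff i := by
  rw [taylor_coeff, ← factorial_smul_hasseDeriv]
  simp

theorem eval_frozenOp (q : ℕ → ℝ[X]) (y : ℝ) (f : ℝ[X]) (x : ℝ) :
    (frozenOp q y f).eval x = frozenFunctional q y (taylor x f) := by
  rw [frozenFunctional, momentFunctional_eq_sum_range _ (n := f.natDegree + 1)
    (by rw [natDegree_taylor]; omega)]
  change (∑ i ∈ Finset.range (f.natDegree + 1), frozen q y i * derivative^[i] f).eval x = _
  rw [eval_finsetSum]
  refine Finset.sum_congr rfl fun i _ => ?_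
  rw [eval_mul, eval_iterate_derivative, frozen, eval_C]
  ring

theorem eval_diffOp (q : ℕ → ℝ[X]) (f : ℝ[X]) (y : ℝ) :
    (diffOp q f).eval y = (frozenOp q y f).eval y := by
  change (∑ i ∈ Finset.range (f.natDegree + 1), q i * derivative^[i] f).eval y =
    (∑ i ∈ Finset.range (f.natDegree + 1), frozen q y i * derivative^[i] f).eval y
  simp [eval_finsetSum, frozen]

theorem coeff_truncSymbol (q : ℕ → ℝ[X]) (y : ℝ) (m i : ℕ) :
    (truncSymbol q y m).coeff i = if i ≤ m then (q i).eval y else 0 := by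
  simp [truncSymbol, finsetSum_coeff]

/-- Truncation loses nothing, because `f` has no coefficients beyond degree `m`. -/
theorem fischerFock_truncSymbol (q : ℕ → ℝ[X]) (y : ℝ) {m : ℕ} {f : ℝ[X]} (hf : f.degree ≤ m) :
    fischerFock (truncSymbol q y m) f = frozenFunctional q y f := by
  have hdeg : (truncSymbol q y m).natDegree < m + 1 := by
    refine Nat.lt_succ_of_le (natDegree_le_iff_coeff_eq_zero.2 fun i hi => ?_)
    rw [coeff_truncSymbol, if_neg (by omega)]
  rw [fischerFock, sum_over_range' _ (fun i => by simp) _ hdeg, frozenFunctional,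
    momentFunctional_eq_sum_range _ (Nat.lt_succ_of_le (natDegree_le_of_degree_le hf))]
  refine Finset.sum_congr rfl fun i hi => ?_
  rw [coeff_truncSymbol, if_pos (Nat.lt_succ_iff.1 (Finset.mem_range.1 hi))]

theorem frozenOp_mem_preservers_iff (q : ℕ → ℝ[X]) (y : ℝ) :
    frozenOp q y ∈ preservers SOS ↔ ∀ f, IsSumSq f → 0 ≤ frozenFunctional q y f := by
  constructor
  · intro h f hf
    have := mem_SOS_iff.1 (h f hf) 0
    rwa [eval_frozenOp, taylor_zero] at this
  · intro h f hf
    refine mem_SOS_iff.2 fun x => ?_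
    rw [eval_frozenOp]
    refine h _ (isSumSq_of_eval_nonneg fun t => ?_)
    rw [taylor_eval]
    exact mem_SOS_iff.1 hf _

theorem diffOp_mem_preservers_iff (q : ℕ → ℝ[X]) :
    diffOp q ∈ preservers SOS ↔ ∀ y, frozenOp q y ∈ preservers SOS := by
  constructor
  · intro h y
    refine (frozenOp_mem_preservers_iff q y).2 fun f hf => ?_
    -- Shifting by `-y` beforehand makes evaluation at `y` return `L_y(f)` itself, for the given
    -- `y`.
    have hg : taylor (-y) f ∈ SOS := mem_SOS_iff.2 fun x => by
      rw [taylor_eval]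
      exact isSumSq_eval_nonneg hf _
    have := mem_SOS_iff.1 (h _ hg) y
    rwa [eval_diffOp, eval_frozenOp, taylor_taylor, add_neg_cancel, taylor_zero] at this
  · intro h f hf
    refine mem_SOS_iff.2 fun y => ?_
    rw [eval_diffOp]
    exact mem_SOS_iff.1 (h y f hf) y

theorem forall_truncSymbol_mem_dualCone_iff (q : ℕ → ℝ[X]) (y : ℝ) :
    (∀ m : ℕ, truncSymbol q y (2 * m) ∈ dualCone (SOSdeg (2 * m))) ↔
      ∀ f, IsSumSq f → 0 ≤ frozenFunctional q y f := by
  constructor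
  · intro h f hf
    have hdeg : f.degree ≤ ((2 * f.natDegree : ℕ) : WithBot ℕ) :=
      degree_le_natDegree.trans (by exact_mod_cast (by omega : f.natDegree ≤ 2 * f.natDegree))
    rw [← fischerFock_truncSymbol q y hdeg]
    exact h f.natDegree f ⟨hf, by exact_mod_cast hdeg⟩
  · rintro h m f ⟨hf, hdeg⟩
    rw [fischerFock_truncSymbol q y (by exact_mod_cast hdeg)]
    exact h f hf

theorem forall_hankel_posSemidef_iff (q : ℕ → ℝ[X]) (y : ℝ) :
    (∀ m : ℕ, (hankel q y m).PosSemidef) ↔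
      ∀ f, IsSumSq f → 0 ≤ frozenFunctional q y f :=
  (forall_posSemidef_iff fun i => (i ! : ℝ) * (q i).eval y).trans
    ⟨fun h _ hf => momentFunctional_nonneg_of_sq h hf, fun h g => h _ (IsSumSq.mul_self g)⟩

/-- The system for the `q_i` is triangular: `x^n` involves only `q_0, …, q_n`, and `q_n` enters with
the invertible factor `n!`. Both existence and uniqueness of the coefficients rest on this. -/
theorem diffOp_X_pow (q : ℕ → ℝ[X]) (n : ℕ) :
    diffOp q (X ^ n) =
      ∑ i ∈ Finset.range n, q i * derivative^[i] (X ^ n : ℝ[X]) + (n ! : ℝ) • q n := by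
  change ∑ i ∈ Finset.range ((X ^ n : ℝ[X]).natDegree + 1), q i * derivative^[i] (X ^ n) = _
  rw [natDegree_X_pow, Finset.sum_range_succ, iterate_derivative_X_pow_eq_smul,
    Nat.descFactorial_self, Nat.sub_self, pow_zero, mul_smul_comm, mul_one, Nat.cast_smul_eq_nsmul]

/-- The coefficients `q_i` of a linear operator, determined recursively from its values on
`x ^ n`. -/
def opCoeff (T : ℝ[X] →ₗ[ℝ] ℝ[X]) (n : ℕ) : ℝ[X] :=
  (n ! : ℝ)⁻¹ • (T (X ^ n) -
    ∑ i ∈ (Finset.range n).attach, opCoeff T i * derivative^[(i : ℕ)] (X ^ n : ℝ[X]))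
termination_by n
decreasing_by exact Finset.mem_range.1 i.2

theorem diffOp_opCoeff (T : ℝ[X] →ₗ[ℝ] ℝ[X]) : T = diffOp (opCoeff T) := by
  refine lhom_ext' fun n => LinearMap.ext_ring ?_
  have hn : (n ! : ℝ) ≠ 0 := by exact_mod_cast n.factorial_ne_zero
  simp only [LinearMap.comp_apply, monomial_one_right_eq_X_pow]
  rw [diffOp_X_pow]
  conv_rhs => rw [opCoeff.eq_1 T n]
  rw [Finset.sum_attach (Finset.range n)
    (fun i => opCoeff T i * derivative^[i] (X ^ n : ℝ[X])), smul_smul, mul_inv_cancel₀ hn,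
    one_smul, add_sub_cancel]

theorem diffOp_injective : Function.Injective diffOp := by
  intro q r h
  funext n
  induction n using Nat.strong_induction_on with
  | _ n ih =>
    have hn : (n ! : ℝ) ≠ 0 := by exact_mod_cast n.factorial_ne_zero
    have hX := LinearMap.congr_fun h (X ^ n)
    rw [diffOp_X_pow, diffOp_X_pow, Finset.sum_congr rfl
      fun i hi => by rw [ih i (Finset.mem_range.1 hi)]] at hX
    exact smul_right_injective _ hn (add_left_cancel hX)

end Operators

/-! ### Haviland's theorem on the line. -/

section MomentProblem

/-- The functions on `ℝ` that are dominated by a polynomial. -/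
def polyDominated : Submodule ℝ (ℝ → ℝ) where
  carrier := {f | ∃ p : ℝ[X], ∀ x, |f x| ≤ p.eval x}
  zero_mem' := ⟨0, fun x => by simp⟩
  add_mem' := by
    rintro f g ⟨p, hp⟩ ⟨r, hr⟩
    exact ⟨p + r, fun x => by
      rw [eval_add]
      exact (abs_add_le _ _).trans (add_le_add (hp x) (hr x))⟩
  smul_mem' := by
    rintro c f ⟨p, hp⟩
    exact ⟨C |c| * p, fun x => by
      rw [eval_mul, eval_C, Pi.smul_apply, smul_eq_mul, abs_mul]
      exact mul_le_mul_of_nonneg_left (hp x) (abs_nonneg c)⟩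

theorem mem_polyDominated_of_abs_le_eval {f : ℝ → ℝ} {p : ℝ[X]} (h : ∀ x, |f x| ≤ |p.eval x|) :
    f ∈ polyDominated :=
  ⟨1 + p * p, fun x => (h x).trans <| by
    rw [eval_add, eval_mul, eval_one, ← abs_mul_abs_self (p.eval x)]
    nlinarith [sq_nonneg (|p.eval x| - 1 / 2)]⟩

/-- Polynomials as functions dominated by a polynomial. -/
def polyDominatedOfPoly : ℝ[X] →ₗ[ℝ] polyDominated where
  toFun p := ⟨fun x => p.eval x, mem_polyDominated_of_abs_le_eval (p := p) fun _ => le_rfl⟩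
  map_add' p r := by
    ext x
    simp
  map_smul' c p := by
    ext x
    simp

theorem polyDominatedOfPoly_injective : Function.Injective polyDominatedOfPoly := by
  intro p r h
  refine Polynomial.funext fun x => ?_
  exact congrFun (congrArg Subtype.val h) x

/-- A functional that is nonnegative on nonnegative polynomials extends to a positive functional
on all functions dominated by a polynomial. -/
theorem exists_positive_extension (L : ℝ[X] →ₗ[ℝ] ℝ)
    (hL : ∀ p : ℝ[X], (∀ x, 0 ≤ p.eval x) → 0 ≤ L p) :
    ∃ G : polyDominated →ₗ[ℝ] ℝ, (∀ p, G (polyDominatedOfPoly p) = L p) ∧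
      ∀ f : polyDominated, (∀ x, 0 ≤ (f : ℝ → ℝ) x) → 0 ≤ G f := by
  let S : PointedCone ℝ polyDominated :=
    { carrier := {f | ∀ x, 0 ≤ (f : ℝ → ℝ) x}
      zero_mem' := fun x => le_rfl
      add_mem' := fun hf hg x => add_nonneg (hf x) (hg x)
      smul_mem' := fun c f hf x => mul_nonneg c.2 (hf x) }
  let e := LinearEquiv.ofInjective polyDominatedOfPoly polyDominatedOfPoly_injective
  let F : polyDominated →ₗ.[ℝ] ℝ :=
    ⟨LinearMap.range polyDominatedOfPoly, L ∘ₗ e.symm.toLinearMap⟩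
  have hF : ∀ p, F ⟨polyDominatedOfPoly p, LinearMap.mem_range_self _ p⟩ = L p := fun p =>
    congrArg L (e.symm_apply_apply p)
  have hnonneg : ∀ f : F.domain, (f : polyDominated) ∈ S → 0 ≤ F f := by
    rintro ⟨_, p, rfl⟩ hp
    rw [hF]
    exact hL p hp
  -- Domination by polynomials is chosen for this hypothesis of the Riesz extension: if `|f| ≤ p`,
  -- then `p + f ≥ 0`.
  have hdense : ∀ f, ∃ g : F.domain, (g : polyDominated) + f ∈ S := by
    rintro ⟨f, p, hp⟩
    refine ⟨⟨polyDominatedOfPoly p, LinearMap.mem_range_self _ p⟩, fun x => ?_⟩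
    change 0 ≤ p.eval x + f x
    linarith [neg_abs_le (f x), hp x]
  obtain ⟨G, hG, hpos⟩ := riesz_extension S F hnonneg hdense
  exact ⟨G, fun p => (hG ⟨_, LinearMap.mem_range_self _ p⟩).trans (hF p), hpos⟩

/-- A continuous cutoff function, equal to `1` on `[-k, k]` and to `0` off `[-(k+1), k+1]`. -/
def cutoff (k : ℕ) (x : ℝ) : ℝ := max 0 (min 1 ((k : ℝ) + 1 - |x|))

theorem continuous_cutoff (k : ℕ) : Continuous (cutoff k) := by
  unfold cutoff
  fun_prop

theorem cutoff_nonneg (k : ℕ) (x : ℝ) : 0 ≤ cutoff k x := le_max_left _ _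

theorem cutoff_le_one (k : ℕ) (x : ℝ) : cutoff k x ≤ 1 :=
  max_le zero_le_one (min_le_left _ _)

theorem cutoff_eq_one {k : ℕ} {x : ℝ} (hx : |x| ≤ k) : cutoff k x = 1 := by
  rw [cutoff, min_eq_left (by linarith), max_eq_right zero_le_one]

theorem cutoff_eq_zero {k : ℕ} {x : ℝ} (hx : (k : ℝ) + 1 ≤ |x|) : cutoff k x = 0 := by
  rw [cutoff, max_eq_left ((min_le_right _ _).trans (by linarith))]

/-- The product of a polynomial with a cutoff function. -/
def cutoffPoly (k : ℕ) (p : ℝ[X]) : C_c(ℝ, ℝ) where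
  toFun x := cutoff k x * p.eval x
  continuous_toFun := (continuous_cutoff k).mul p.continuous
  hasCompactSupport' := by
    refine HasCompactSupport.intro (isCompact_Icc (a := -((k : ℝ) + 1)) (b := (k : ℝ) + 1))
      fun x hx => ?_
    rw [Set.mem_Icc, ← abs_le, not_le] at hx
    rw [cutoff_eq_zero hx.le, zero_mul]

theorem cutoffPoly_apply (k : ℕ) (p : ℝ[X]) (x : ℝ) :
    cutoffPoly k p x = cutoff k x * p.eval x := rfl

/-- The truncation error of `p` at level `k` is at most `(x² + p²) / k`. -/
theorem mul_abs_eval_sub_cutoffPoly_le (k : ℕ) (p : ℝ[X]) (x : ℝ) :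
    (k : ℝ) * |p.eval x - cutoffPoly k p x| ≤ (X * X + p * p).eval x := by
  simp only [eval_add, eval_mul, eval_X, cutoffPoly_apply]
  rcases le_total |x| k with hx | hx
  · rw [cutoff_eq_one hx, one_mul, sub_self, abs_zero, mul_zero]
    exact add_nonneg (mul_self_nonneg _) (mul_self_nonneg _)
  -- Here `k ≤ |x|`, so `k` times the error is at most `|x| |p(x)| ≤ x² + p(x)²`.
  · have h1 : |p.eval x - cutoff k x * p.eval x| ≤ |p.eval x| := by
      rw [← one_sub_mul, abs_mul, abs_of_nonneg (sub_nonneg.2 (cutoff_le_one k x))]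
      exact mul_le_of_le_one_left (abs_nonneg _) (by linarith [cutoff_nonneg k x])
    rw [← abs_mul_abs_self x, ← abs_mul_abs_self (p.eval x)]
    have h2 := mul_le_mul hx h1 (abs_nonneg _) (abs_nonneg x)
    nlinarith [sq_nonneg (|x| - |p.eval x|), mul_nonneg (abs_nonneg x) (abs_nonneg (p.eval x))]

theorem mem_polyDominated_of_compactlySupported (u : C_c(ℝ, ℝ)) : ⇑u ∈ polyDominated := by
  obtain ⟨M, hM⟩ := u.hasCompactSupport.exists_bound_of_continuous u.continuous
  exact ⟨C M, fun x => by simpa using hM x⟩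

/-- Compactly supported continuous functions are dominated by polynomials. -/
def polyDominatedOfCompact : C_c(ℝ, ℝ) →ₗ[ℝ] polyDominated where
  toFun u := ⟨u, mem_polyDominated_of_compactlySupported u⟩
  map_add' _ _ := rfl
  map_smul' _ _ := rfl

theorem monotone_of_nonneg {G : polyDominated →ₗ[ℝ] ℝ}
    (hG : ∀ f : polyDominated, (∀ x, 0 ≤ (f : ℝ → ℝ) x) → 0 ≤ G f) {f g : polyDominated}
    (h : ∀ x, (f : ℝ → ℝ) x ≤ (g : ℝ → ℝ) x) : G f ≤ G g := by
  rw [← sub_nonneg, ← map_sub]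
  exact hG _ fun x => sub_nonneg.2 (h x)

/-- **Haviland's theorem** on the line: a linear functional on `ℝ[x]` that is nonnegative on
nonnegative polynomials is the integral against a nonnegative Borel measure. -/
theorem exists_measure_of_nonneg (L : ℝ[X] →ₗ[ℝ] ℝ)
    (hL : ∀ p : ℝ[X], (∀ x, 0 ≤ p.eval x) → 0 ≤ L p) :
    ∃ μ : Measure ℝ, ∀ p : ℝ[X], Integrable (fun x => p.eval x) μ ∧ ∫ x, p.eval x ∂μ = L p := by
  obtain ⟨G, hGL, hG⟩ := exists_positive_extension L hL
  let Λ : C_c(ℝ, ℝ) →ₚ[ℝ] ℝ :=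
    PositiveLinearMap.mk₀ (G ∘ₗ polyDominatedOfCompact) fun u hu => hG _ fun x => hu x
  let μ := RealRMK.rieszMeasure Λ
  have hμ : ∀ u : C_c(ℝ, ℝ), ∫ x, u x ∂μ = G (polyDominatedOfCompact u) :=
    RealRMK.integral_rieszMeasure Λ
  have hcomp : ∀ u : C_c(ℝ, ℝ), Integrable u μ := fun u =>
    u.continuous.integrable_of_hasCompactSupport u.hasCompactSupport
  -- `μ` is so far only tied to `G` on compactly supported functions. For `p ≥ 0` its integrals over
  -- `[-k, k]` are bounded by `L p` through the cutoffs, which gives integrability.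
  have hint_nonneg : ∀ p : ℝ[X], (∀ x, 0 ≤ p.eval x) → Integrable (fun x => p.eval x) μ := by
    intro p hp
    have hcov : AECover μ atTop fun k : ℕ => Set.Icc (-(k : ℝ)) k :=
      aecover_Icc (tendsto_neg_atTop_atBot.comp tendsto_natCast_atTop_atTop)
        tendsto_natCast_atTop_atTop
    refine hcov.integrable_of_integral_bounded_of_nonneg_ae (L p)
      (fun k => p.continuous.continuousOn.integrableOn_compact isCompact_Icc)
      (Eventually.of_forall hp) (Eventually.of_forall fun k => ?_)
    calc ∫ x in Set.Icc (-(k : ℝ)) k, p.eval x ∂μ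
        = ∫ x in Set.Icc (-(k : ℝ)) k, cutoffPoly k p x ∂μ := by
          refine setIntegral_congr_fun measurableSet_Icc fun x hx => ?_
          rw [cutoffPoly_apply, cutoff_eq_one (abs_le.2 hx), one_mul]
      _ ≤ ∫ x, cutoffPoly k p x ∂μ :=
          setIntegral_le_integral (hcomp _)
            (Eventually.of_forall fun x => mul_nonneg (cutoff_nonneg k x) (hp x))
      _ ≤ L p := by
          rw [hμ, ← hGL]
          exact monotone_of_nonneg hG fun x =>
            mul_le_of_le_one_left (hp x) (cutoff_le_one k x)
  have hint : ∀ p : ℝ[X], Integrable (fun x => p.eval x) μ := by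
    intro p
    refine (hint_nonneg (1 + p * p) fun x => ?_).mono' p.continuous.aestronglyMeasurable
      (Eventually.of_forall fun x => ?_)
    · rw [eval_add, eval_mul, eval_one]
      exact add_nonneg zero_le_one (mul_self_nonneg _)
    · rw [Real.norm_eq_abs, eval_add, eval_mul, eval_one, ← abs_mul_abs_self (p.eval x)]
      nlinarith [sq_nonneg (|p.eval x| - 1 / 2)]
  refine ⟨μ, fun p => ⟨hint p, ?_⟩⟩
  -- This one polynomial bounds the truncation error both under `μ` and under `G`, so `k |∫ p dμ - L
  -- p|` is bounded independently of `k`, forcing equality.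
  set r : ℝ[X] := X * X + p * p
  have hbound : ∀ k : ℕ, (k : ℝ) * |(∫ x, p.eval x ∂μ) - L p| ≤ (∫ x, r.eval x ∂μ) + L r := by
    intro k
    have h1 : (k : ℝ) * |(∫ x, p.eval x ∂μ) - ∫ x, cutoffPoly k p x ∂μ| ≤ ∫ x, r.eval x ∂μ := by
      rw [← integral_sub (hint p) (hcomp _)]
      refine (mul_le_mul_of_nonneg_left (abs_integral_le_integral_abs) k.cast_nonneg).trans ?_
      rw [← integral_const_mul]
      exact integral_mono (((hint p).sub (hcomp _)).abs.const_mul _) (hint r)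
        (mul_abs_eval_sub_cutoffPoly_le k p)
    have h2 : (k : ℝ) * |L p - ∫ x, cutoffPoly k p x ∂μ| ≤ L r := by
      rw [hμ, ← hGL, ← hGL, ← map_sub, ← abs_of_nonneg (k.cast_nonneg (α := ℝ)), ← abs_mul,
        ← smul_eq_mul, ← map_smul]
      have hle : ∀ x, (k : ℝ) * |p.eval x - cutoffPoly k p x| ≤ r.eval x :=
        mul_abs_eval_sub_cutoffPoly_le k p
      have habs : ∀ x, |(k : ℝ) * (p.eval x - cutoffPoly k p x)| ≤ r.eval x := fun x => by
        rw [abs_mul, Nat.abs_cast]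
        exact hle x
      refine abs_le'.2 ⟨monotone_of_nonneg hG fun x => (abs_le'.1 (habs x)).1, ?_⟩
      rw [← map_neg]
      exact monotone_of_nonneg hG fun x => (abs_le'.1 (habs x)).2
    calc (k : ℝ) * |(∫ x, p.eval x ∂μ) - L p|
        ≤ k * (|(∫ x, p.eval x ∂μ) - ∫ x, cutoffPoly k p x ∂μ| +
            |L p - ∫ x, cutoffPoly k p x ∂μ|) := by
          refine mul_le_mul_of_nonneg_left ?_ k.cast_nonneg
          rw [abs_sub_comm (L p)]
          exact abs_sub_le _ _ _
      _ ≤ _ := by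
          rw [mul_add]
          exact add_le_add h1 h2
  by_contra hne
  have hpos : 0 < |(∫ x, p.eval x ∂μ) - L p| := abs_pos.2 (sub_ne_zero.2 hne)
  obtain ⟨k, hk⟩ := exists_nat_gt (((∫ x, r.eval x ∂μ) + L r) / |(∫ x, p.eval x ∂μ) - L p|)
  rw [div_lt_iff₀ hpos] at hk
  exact (hbound k).not_gt hk

end MomentProblem

/-! ### Representing measures and the convolution formula. -/

section Representation

variable {q : ℕ → ℝ[X]}

theorem HasFiniteMoments.integrable_eval {μ : Measure ℝ} (hμ : HasFiniteMoments μ) (f : ℝ[X]) :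
    Integrable (fun t => f.eval t) μ := by
  simp_rw [eval_eq_sum_range]
  exact integrable_finsetSum _ fun i _ => (hμ i).const_mul _

theorem IsRepresentingFamily.integral_eval {μ : ℝ → Measure ℝ} (hμ : IsRepresentingFamily q μ)
    (y : ℝ) (f : ℝ[X]) : ∫ t, f.eval t ∂(μ y) = frozenFunctional q y f := by
  simp_rw [eval_eq_sum_range]
  rw [integral_finsetSum _ fun i _ => (hμ.finite_moments y i).const_mul _, frozenFunctional,
    momentFunctional_eq_sum_range _ (Nat.lt_succ_self _)]
  refine Finset.sum_congr rfl fun i _ => ?_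
  rw [integral_const_mul, hμ.moments_eq, mul_comm]

theorem IsRepresentingFamily.frozenFunctional_nonneg {μ : ℝ → Measure ℝ}
    (hμ : IsRepresentingFamily q μ) (y : ℝ) {f : ℝ[X]} (hf : IsSumSq f) :
    0 ≤ frozenFunctional q y f := by
  rw [← hμ.integral_eval]
  exact integral_nonneg fun t => isSumSq_eval_nonneg hf t

theorem exists_isRepresentingFamily (h : ∀ y f, IsSumSq f → 0 ≤ frozenFunctional q y f) :
    ∃ μ : ℝ → Measure ℝ, IsRepresentingFamily q μ := by
  choose μ hμ using fun y => exists_measure_of_nonneg (frozenFunctional q y)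
    fun p hp => h y p (isSumSq_of_eval_nonneg hp)
  have hmom : ∀ y i, (i ! : ℝ) * (q i).eval y = ∫ t, t ^ i ∂(μ y) := fun y i => by
    have := (hμ y (X ^ i)).2
    rw [frozenFunctional, momentFunctional_X_pow] at this
    simpa using this.symm
  -- The measures may be chosen independently for each `y`: their moments `i! q_i(y)` are polynomial
  -- in `y` automatically.
  exact ⟨μ, fun s m => by simpa using (hμ s (X ^ m)).1,
    fun i => ⟨C (i ! : ℝ) * q i, fun s => by rw [← hmom, eval_mul, eval_C]⟩, hmom⟩

theorem IsRepresentingFamily.eval_frozenOp_eq_integral {μ : ℝ → Measure ℝ}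
    (hμ : IsRepresentingFamily q μ) (f : ℝ[X]) (y x : ℝ) :
    Integrable (fun t : ℝ => f.eval (t + x)) (μ y) ∧
      (frozenOp q y f).eval x = ∫ t, f.eval (t + x) ∂(μ y) := by
  simp_rw [← taylor_eval]
  exact ⟨(hμ.finite_moments y).integrable_eval _, by rw [eval_frozenOp, hμ.integral_eval]⟩

end Representation

end SosPreserver

end

theorem theorem2p1 (T : ℝ[X] →ₗ[ℝ] ℝ[X]) :
    (∃! q : ℕ → ℝ[X], T = diffOp q) ∧
    ∀ q : ℕ → ℝ[X], T = diffOp q →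
      List.TFAE [
        T ∈ preservers SOS,
        ∀ y : ℝ, frozenOp q y ∈ preservers SOS,
        ∀ (y : ℝ) (m : ℕ), truncSymbol q y (2 * m) ∈ dualCone (SOSdeg (2 * m)),
        ∀ (y : ℝ) (m : ℕ), (hankel q y m).PosSemidef,
        ∃ μ : ℝ → Measure ℝ, IsRepresentingFamily q μ] ∧
      ∀ μ : ℝ → Measure ℝ, IsRepresentingFamily q μ →
        ∀ (f : ℝ[X]) (y x : ℝ),
          Integrable (fun t : ℝ => f.eval (t + x)) (μ y) ∧
          (frozenOp q y f).eval x = ∫ t, f.eval (t + x) ∂(μ y) := by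
  refine ⟨⟨opCoeff T, diffOp_opCoeff T, fun q hq =>
    diffOp_injective (hq.symm.trans (diffOp_opCoeff T))⟩, ?_⟩
  rintro q rfl
  refine ⟨?_, fun μ hμ => hμ.eval_frozenOp_eq_integral⟩
  simp only [diffOp_mem_preservers_iff, frozenOp_mem_preservers_iff,
    forall_truncSymbol_mem_dualCone_iff, forall_hankel_posSemidef_iff]
  have hrep : (∀ y f, IsSumSq f → 0 ≤ frozenFunctional q y f) ↔
      ∃ μ : ℝ → Measure ℝ, IsRepresentingFamily q μ :=
    ⟨exists_isRepresentingFamily, fun ⟨_, hμ⟩ y _ hf => hμ.frozenFunctional_nonneg y hf⟩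
  rw [← hrep]
  tfae_finish
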